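/- Let $d\ge 3$. For $k\in\mathbb R^d$ write $k_x=k_1$ for the first component and $\Lambda(k)=k_1(k_1^2+\dots+k_d^2)$; for $L>0$ let $\mathbb Z_L^d=L^{-1}\mathbb Z^d$. For $\alpha>0$, $\varepsilon>0$ put $T_{\max}=L^{-\varepsilon}\alpha^{-2}$, $Q=L^dT_{\max}^{-1}$ and $\mathcal D(\alpha,1)=\{2^{-K}:K\in\mathbb Z\cap[0,\ln\alpha^{-1}]\}$. Fix constants $c_0,c_1,c_2>0$. A couple $\mathcal C=\mathcal C(T,T',p)$ consists of two finite binary trees $T,T'$ (every vertex has $0$ or $2$ children), each with an extra edge, its leg ($\mathfrak l$ resp. $\mathfrak l'$), attached above its root, together with a pairing $p$ (a partition into two-element subsets) of the set of all leaves of $T$ and $T'$; the edges above two paired leaves are merged into one edge and the leaves are deleted. The nodes of $\mathcal C$ are the branching (non-leaf) vertices of $T$ and $T'$; $n$ is their number. An edge of $T$ or $T'$ (legs included) is called normal if its lower endpoint is not a leaf, and $\mathcal C_{\rm norm}$ denotes the set of normal edges. $\mathcal C$ is connected if the resulting graph (the nodes, the outer ends of the two legs, and the edges) is connected. Given $\sigma_{\mathfrak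 n}\in\mathbb R$ for each node and $\kappa_{\mathfrak e}\in\{0\}\cup\mathcal D(\alpha,1)$ for each normal edge, consider the families of vectors $k_{\mathfrak e}\in\mathbb Z_L^d$, $|k_{\mathfrak e}|\le c_0$, indexed by the edges of $T$ and $T'$, such that * $k_{\mathfrak e}=-k_{\mathfrak f}$ whenever $\mathfrak e,\mathfrak f$ are the edges above two paired leaves (so there is one unknown per edge of $\mathcal C$); * $|k_{\mathfrak e,x}|\sim\kappa_{\mathfrak e}$ for every normal edge $\mathfrak e$, i.e. $\tfrac12\kappa_{\mathfrak e}\le|k_{\mathfrak e,x}|\le2\kappa_{\mathfrak e}$ if $\kappa_{\mathfrak e}\ne0$, and $0<|k_{\mathfrak e,x}|\le c_2\alpha^2$ if $\kappa_{\mathfrak e}=0$; * at every node $\mathfrak n$, with upper edge $\mathfrak e$ and lower edges $\mathfrak e_1,\mathfrak e_2$, $$k_{\mathfrak e_1}+k_{\mathfrak e_2}-k_{\mathfrak e}=0,\qquad |\Lambda(k_{\mathfrak e_1})+\Lambda(k_{\mathfrak e_2})-\Lambda(k_{\mathfrak e})-\sigma_{\mathfrak n}|\le c_1T_{\max}^{-1}.$$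 Then there is a constant $A>0$ depending only on $d,c_0,c_1,c_2$ such that for all $\theta>0$ and $\varepsilon>0$ there is $L_0\ge 1$ with the following property. For all $L\ge L_0$, all $\alpha>0$ with $\alpha^{-1}\le L^{1/2}$, all connected couples $\mathcal C$, all $\kappa_{\mathfrak e}$, $\sigma_{\mathfrak n}$ as above and all $k\in\mathbb R^d$, the number $M$ of such families in which one of the two legs is fixed, $k_{\mathfrak l}=k$ (or $k_{\mathfrak l'}=k$), and the other one is free, and likewise the number $M$ of such families with $k_{\mathfrak l}=-k_{\mathfrak l'}=k$, satisfies $$M\le L^{A n\theta}\,Q^{n/2}\prod_{\mathfrak e\in\mathcal C_{\rm norm}}\kappa_{\mathfrak e}^{-1}\qquad(\text{with } 0^{-1}=\infty).$$ -/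

import Mathlib

open scoped ENNReal

noncomputable section

/-! ### Binary trees

A finite binary tree (each vertex has `0` or `2` children) is a `BinaryTree Unit`: `BinaryTree.nil`
is the tree whose only vertex is a leaf, and `BinaryTree.node () l r` has a branching root with
subtrees `l`, `r`. A leg is attached on top of the root, so that every vertex has exactly one edge above it. -/

namespace BinTree

/-- The branching (that is, non-leaf) vertices of a binary tree. -/
def Branch : BinaryTree Unit → Type
  | .nil => Empty
  | .node _ l r => Unit ⊕ (Branch l ⊕ Branch r)

/-- The leaves of a binary tree. -/
def Leaf : BinaryTree Unit → Type
  | .nil => Unit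
  | .node _ l r => Leaf l ⊕ Leaf r

instance instFintypeBranch : (t : BinaryTree Unit) → Fintype (Branch t)
  | .nil => inferInstanceAs (Fintype Empty)
  | .node _ l r =>
    letI := instFintypeBranch l
    letI := instFintypeBranch r
    inferInstanceAs (Fintype (Unit ⊕ (Branch l ⊕ Branch r)))

/-- The edges of a binary tree, including the leg above the root. An edge is named after its lower
endpoint: `Sum.inl b` is the edge above the branching vertex `b` (a normal edge), `Sum.inr ℓ` is the
edge above the leaf `ℓ` (a leaf edge). -/
abbrev Edge (t : BinaryTree Unit) : Type := Branch t ⊕ Leaf t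

/-- An edge of the left subtree, seen in the whole tree. -/
def inLeft {a : Unit} {l r : BinaryTree Unit} : Edge l → Edge (.node a l r)
  | .inl b => .inl (.inr (.inl b))
  | .inr ℓ => .inr (.inl ℓ)

/-- An edge of the right subtree, seen in the whole tree. -/
def inRight {a : Unit} {l r : BinaryTree Unit} : Edge r → Edge (.node a l r)
  | .inl b => .inl (.inr (.inr b))
  | .inr ℓ => .inr (.inr ℓ)

/-- The root leg, i.e. the edge above the root. -/
def leg : (t : BinaryTree Unit) → Edge t
  | .nil => .inr ()
  | .node _ _ _ => .inl (.inl ())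

/-- The edge from a branching vertex down to its first child. -/
def child₁ : (t : BinaryTree Unit) → Branch t → Edge t
  | .node _ l _, .inl () => inLeft (leg l)
  | .node _ l _, .inr (.inl b) => inLeft (child₁ l b)
  | .node _ _ r, .inr (.inr b) => inRight (child₁ r b)

/-- The edge from a branching vertex down to its second child. -/
def child₂ : (t : BinaryTree Unit) → Branch t → Edge t
  | .node _ _ r, .inl () => inRight (leg r)
  | .node _ l _, .inr (.inl b) => inLeft (child₂ l b)
  | .node _ _ r, .inr (.inr b) => inRight (child₂ r b)

/-- `IsUpper t v e`: the upper endpoint of the edge `e` is `v`. Here `some b` stands for the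
branching vertex `b` and `none` for the outer endpoint of the leg. -/
def IsUpper (t : BinaryTree Unit) : Option (Branch t) → Edge t → Prop
  | none, e => e = leg t
  | some b, e => e = child₁ t b ∨ e = child₂ t b

/-- `IsLower t v e`: the lower endpoint of the edge `e` is the branching vertex `v`. -/
def IsLower (t : BinaryTree Unit) (v : Option (Branch t)) (e : Edge t) : Prop :=
  ∃ b, v = some b ∧ e = .inl b

end BinTree

/-! ### Couples -/

/-- A couple `C(T, T', p)`: two binary trees `T = tree 0`, `T' = tree 1`, and a pairing `p` of the
set of all their leaves, along which the leaf edges are merged (the leaves themselves disappear). -/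
structure Couple where
  /-- the two trees -/
  tree : Fin 2 → BinaryTree Unit
  /-- the partner of a leaf -/
  pair : (Σ i, BinTree.Leaf (tree i)) → (Σ i, BinTree.Leaf (tree i))
  pair_pair : ∀ ℓ, pair (pair ℓ) = ℓ
  pair_ne : ∀ ℓ, pair ℓ ≠ ℓ

namespace Couple

variable (C : Couple)

/-- The (degree three) nodes of a couple: the branching vertices of the two trees. -/
abbrev Node : Type := Σ i, BinTree.Branch (C.tree i)

/-- The total number `n` of nodes of a couple. -/
def numNodes : ℕ := Fintype.card C.Node

/-- The normal edges of a couple: the edges of the two trees (legs included) whose lower endpoint is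
not a leaf. They are indexed by their lower endpoint. -/
abbrev NormalEdge : Type := Σ i, BinTree.Branch (C.tree i)

/-- The edges of the two trees of a couple, before merging. -/
abbrev TreeEdge : Type := Σ i, BinTree.Edge (C.tree i)

/-- A normal edge as an edge of one of the trees. -/
def normal (e : C.NormalEdge) : C.TreeEdge := ⟨e.1, .inl e.2⟩

/-- The edge above a leaf, as an edge of one of the trees. -/
def leafEdge (ℓ : Σ i, BinTree.Leaf (C.tree i)) : C.TreeEdge := ⟨ℓ.1, .inr ℓ.2⟩

/-- The two legs of a couple: `leg 0` is the root leg `𝔩` of `T`, `leg 1` the root leg `𝔩'` of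
`T'`. -/
def leg (i : Fin 2) : C.TreeEdge := ⟨i, BinTree.leg (C.tree i)⟩

/-- The edge above a node. -/
def parent (v : C.Node) : C.TreeEdge := ⟨v.1, .inl v.2⟩

/-- The first edge below a node. -/
def child₁ (v : C.Node) : C.TreeEdge := ⟨v.1, BinTree.child₁ (C.tree v.1) v.2⟩

/-- The second edge below a node. -/
def child₂ (v : C.Node) : C.TreeEdge := ⟨v.1, BinTree.child₂ (C.tree v.1) v.2⟩

/-- The vertices of a couple as a graph: the nodes (of degree three), and the outer endpoints
(of degree one) `⟨i, none⟩` of the two legs. -/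
abbrev Vertex : Type := Σ i, Option (BinTree.Branch (C.tree i))

/-- A vertex of the couple is an endpoint of an edge of one of the trees (leaves are no vertices of
the couple). -/
def Incident (v : C.Vertex) (e : C.TreeEdge) : Prop :=
  ∃ (i : Fin 2) (w : Option (BinTree.Branch (C.tree i))) (f : BinTree.Edge (C.tree i)),
    v = ⟨i, w⟩ ∧ e = ⟨i, f⟩ ∧ (BinTree.IsUpper _ w f ∨ BinTree.IsLower _ w f)

/-- Two tree edges give the same edge of the couple: they are equal, or they are the edges above two
paired leaves. -/
def Merged (e f : C.TreeEdge) : Prop :=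
  e = f ∨ ∃ ℓ, e = C.leafEdge ℓ ∧ f = C.leafEdge (C.pair ℓ)

/-- The graph underlying a couple (up to multiplicities of edges and loops): distinct vertices are
adjacent when they are endpoints of a common edge of the couple. -/
def graph : SimpleGraph C.Vertex :=
  SimpleGraph.fromRel fun u v => ∃ e f, C.Merged e f ∧ C.Incident u e ∧ C.Incident v f

/-- A couple is connected if it is connected as a graph. -/
def IsConnected : Prop := C.graph.Connected

end Couple

/-! ### The counting problem -/

namespace ZK

/-- The first component `k_x` of a vector. -/
def xcoord {d : ℕ} [NeZero d] (k : EuclideanSpace ℝ (Fin d)) : ℝ := k 0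

/-- The dispersion relation `Λ(k) = k_1 (k_1² + ⋯ + k_d²)`. -/
def Lam {d : ℕ} [NeZero d] (k : EuclideanSpace ℝ (Fin d)) : ℝ := xcoord k * ∑ i, k i ^ 2

/-- The lattice `ℤ_L^d = L⁻¹ ℤ^d`. -/
def lattice (d : ℕ) (L : ℝ) : Set (EuclideanSpace ℝ (Fin d)) :=
  {k | ∃ K : Fin d → ℤ, ∀ i, k i = (K i : ℝ) / L}

/-- The dyadic numbers `𝒟(α, 1) = {2^{-K} : K ∈ ℤ ∩ [0, ln α⁻¹]}`. -/
def dyadic (α : ℝ) : Set ℝ :=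
  {x | ∃ K : ℤ, 0 ≤ K ∧ (K : ℝ) ≤ Real.log α⁻¹ ∧ x = (2 : ℝ) ^ (-K)}

/-- The relation `|x| ∼ κ`: it means `κ / 2 ≤ |x| ≤ 2 κ` if `κ ≠ 0`, and `0 < |x| ≤ c α²` if
`κ = 0`. -/
def DyadicSim (c α x κ : ℝ) : Prop :=
  (κ ≠ 0 → κ / 2 ≤ |x| ∧ |x| ≤ 2 * κ) ∧ (κ = 0 → |x| ≤ c * α ^ 2 ∧ x ≠ 0)

/-- The maximal time `T_max = L^{-ε} α^{-2}`. -/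
def Tmax (ε L α : ℝ) : ℝ := L ^ (-ε) * (α ^ 2)⁻¹

/-- The quantity `Q = L^d T_max⁻¹`. -/
def Q (d : ℕ) (ε L α : ℝ) : ℝ := L ^ d * (Tmax ε L α)⁻¹

/-- The momentum / energy system of a couple, without conditions on the legs. A solution assigns a
vector `k e ∈ ℤ_L^d` with `|k e| ≤ c₀` to every edge, where merging two leaf edges means that their
vectors are opposite; the normal edges have `|k_x| ∼ κ`, and every node satisfies momentum
conservation `k₁ + k₂ - k = 0` and energy conservation
`Λ(k₁) + Λ(k₂) - Λ(k) = σ + O(T_max⁻¹)`, the error being at most `c₁ T_max⁻¹`. -/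
def system {d : ℕ} [NeZero d] (c₀ c₁ c₂ ε L α : ℝ) (C : Couple)
    (κ : C.NormalEdge → ℝ) (σ : C.Node → ℝ) : Set (C.TreeEdge → EuclideanSpace ℝ (Fin d)) :=
  {k |
    (∀ e, k e ∈ lattice d L ∧ ‖k e‖ ≤ c₀) ∧
    (∀ ℓ, k (C.leafEdge ℓ) = -k (C.leafEdge (C.pair ℓ))) ∧
    (∀ e, DyadicSim c₂ α (xcoord (k (C.normal e))) (κ e)) ∧
    (∀ v, k (C.child₁ v) + k (C.child₂ v) - k (C.parent v) = 0) ∧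
    (∀ v, |Lam (k (C.child₁ v)) + Lam (k (C.child₂ v)) - Lam (k (C.parent v)) - σ v|
      ≤ c₁ * (Tmax ε L α)⁻¹)}

/-- The system with exactly one fixed leg: the vector of the leg `i` is fixed to be `c`, that of the
other leg is free. -/
def oneFixed {d : ℕ} [NeZero d] (c₀ c₁ c₂ ε L α : ℝ) (C : Couple)
    (κ : C.NormalEdge → ℝ) (σ : C.Node → ℝ) (i : Fin 2) (c : EuclideanSpace ℝ (Fin d)) :
    Set (C.TreeEdge → EuclideanSpace ℝ (Fin d)) :=
  {k ∈ system c₀ c₁ c₂ ε L α C κ σ | k (C.leg i) = c}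

/-- The system with both legs fixed: `k_𝔩 = - k_𝔩' = c`. -/
def bothFixed {d : ℕ} [NeZero d] (c₀ c₁ c₂ ε L α : ℝ) (C : Couple)
    (κ : C.NormalEdge → ℝ) (σ : C.Node → ℝ) (c : EuclideanSpace ℝ (Fin d)) :
    Set (C.TreeEdge → EuclideanSpace ℝ (Fin d)) :=
  {k ∈ system c₀ c₁ c₂ ε L α C κ σ | k (C.leg 0) = c ∧ -k (C.leg 1) = c}

/-- The bound `L^{A n θ} Q^{n/2} ∏_{e normal} κ_e⁻¹`, with `0⁻¹ = ∞`. -/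
def bound (d : ℕ) (A θ ε L α : ℝ) (C : Couple) (κ : C.NormalEdge → ℝ) : ℝ≥0∞ :=
  ENNReal.ofReal (L ^ (A * C.numNodes * θ) * Q d ε L α ^ ((C.numNodes : ℝ) / 2)) *
    ∏ e : C.NormalEdge, (ENNReal.ofReal (κ e))⁻¹

end ZK

end

/-! ### Linear conservation laws on a binary tree -/

namespace BinTree

/-! Momentum conservation makes each leg the sum of the leaf vectors of its tree, and the pairing
makes all leaf vectors cancel, so the two legs are opposite and fixing one fixes both. The
difference of two solutions is then, in each coordinate, a scalar flow vanishing on the legs. Such a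
flow is an odd function on the `n + 2` leaves with zero sum over the first tree. Odd functions have
dimension at most `(n + 2) / 2`, and connectedness makes the sum condition nontrivial, so the flows
have dimension at most `n / 2` (`IsConnected.two_mul_finrank_flows_le`).

Solutions are counted by descending the trees (`card_le_pow_finrank_flows`). Below a node whose
upper edge is known, the two lower edges are either already forced linearly, at no cost, or fixing
them lowers the dimension of the remaining flows. So at most `n / 2` nodes cost a factor.

That factor comes from `card_node_le`. With the upper vector `a` and all but two coordinates of a
lower vector frozen, the first one among the frozen, the energy is a circular quadratic form with
leading coefficient `a_x`. The two free coordinates lie in a planar annulus, which gives `Q / κ` up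
to a logarithm, absorbed by `L ^ θ`. Since `κ⁻¹ ≥ 1`, the nodes without cost may carry their `κ⁻¹`
too. -/

instance instFintypeLeaf : (t : BinaryTree Unit) → Fintype (Leaf t)
  | .nil => inferInstanceAs (Fintype Unit)
  | .node _ l r =>
    letI := instFintypeLeaf l
    letI := instFintypeLeaf r
    inferInstanceAs (Fintype (Leaf l ⊕ Leaf r))

theorem card_leaf : ∀ t : BinaryTree Unit, Fintype.card (Leaf t) = Fintype.card (Branch t) + 1
  | .nil => rfl
  | .node a l r => by
    have h₁ : Fintype.card (Leaf (.node a l r)) = Fintype.card (Leaf l ⊕ Leaf r) :=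
      Fintype.card_congr (Equiv.refl _)
    have h₂ : Fintype.card (Branch (.node a l r)) =
        Fintype.card (Unit ⊕ (Branch l ⊕ Branch r)) := Fintype.card_congr (Equiv.refl _)
    rw [h₁, h₂, Fintype.card_sum, Fintype.card_sum, Fintype.card_sum, card_leaf l, card_leaf r,
      Fintype.card_unit]
    omega

theorem apply_leg_eq_sum {M : Type*} [AddCommMonoid M] : ∀ (t : BinaryTree Unit) (f : Edge t → M),
    (∀ b, f (child₁ t b) + f (child₂ t b) = f (.inl b)) → f (leg t) = ∑ ℓ, f (.inr ℓ)
  | .nil, f, _ => (Fintype.sum_unique (ι := Unit) fun ℓ => f (.inr ℓ)).symm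
  | .node a l r, f, h => by
    have h₁ : f (inLeft (leg l)) = ∑ ℓ, f (inLeft (.inr ℓ)) :=
      apply_leg_eq_sum l (fun e => f (inLeft e)) fun b => h (.inr (.inl b))
    have h₂ : f (inRight (leg r)) = ∑ ℓ, f (inRight (.inr ℓ)) :=
      apply_leg_eq_sum r (fun e => f (inRight e)) fun b => h (.inr (.inr b))
    have h₃ : ∑ ℓ, f (.inr ℓ) = ∑ ℓ : Leaf l ⊕ Leaf r, f (.inr ℓ) :=
      Fintype.sum_equiv (Equiv.refl _) _ _ fun _ => rfl
    rw [h₃, Fintype.sum_sum_type]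
    refine (h (.inl ())).symm.trans ?_
    exact congrArg₂ (· + ·) h₁ h₂

/-- Every normal edge is the leg of the subtree below it, hence carries the sum of that subtree's
leaf values. This makes flows determined by their leaves. -/
theorem eq_zero_of_leaf_eq_zero {M : Type*} [AddCommMonoid M] :
    ∀ (t : BinaryTree Unit) (f : Edge t → M),
      (∀ b, f (child₁ t b) + f (child₂ t b) = f (.inl b)) → (∀ ℓ, f (.inr ℓ) = 0) →
        ∀ b, f (.inl b) = 0
  | .nil, _, _, _ => fun b => b.elim
  | .node a l r, f, h, h0 => by
    rintro (⟨⟩ | b | b)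
    · exact (apply_leg_eq_sum _ f h).trans (Finset.sum_eq_zero fun ℓ _ => h0 ℓ)
    · exact eq_zero_of_leaf_eq_zero l (fun e => f (inLeft e)) (fun b => h (.inr (.inl b)))
        (fun ℓ => h0 (.inl ℓ)) b
    · exact eq_zero_of_leaf_eq_zero r (fun e => f (inRight e)) (fun b => h (.inr (.inr b)))
        (fun ℓ => h0 (.inr ℓ)) b

/-- The number of branching vertices strictly above a branching vertex. -/
def depth : (t : BinaryTree Unit) → Branch t → ℕ
  | .node _ _ _, .inl () => 0
  | .node _ l _, .inr (.inl b) => depth l b + 1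
  | .node _ _ r, .inr (.inr b) => depth r b + 1

/-- The depth clause justifies the top-down order of the count: the upper edge of a shallowest
unprocessed node is a leg or lies below a processed node. -/
theorem eq_leg_or_exists_isUpper : ∀ (t : BinaryTree Unit) (e : Edge t),
    e = leg t ∨ ∃ b, IsUpper t (some b) e ∧ ∀ b', e = .inl b' → depth t b < depth t b'
  | .nil, .inl b => b.elim
  | .nil, .inr () => .inl rfl
  | .node a l r, e => by
    have hl : ∀ e' : Edge l, e = inLeft e' →
        ∃ b, IsUpper (.node a l r) (some b) e ∧
          ∀ b', e = .inl b' → depth (.node a l r) b < depth (.node a l r) b' := by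
      rintro e' rfl
      rcases eq_leg_or_exists_isUpper l e' with rfl | ⟨b, hb, hd⟩
      · refine ⟨.inl (), .inl rfl, fun b' hb' => ?_⟩
        rcases b' with ⟨⟩ | b' | b'
        · cases h : leg l <;> rw [h] at hb' <;> cases hb'
        · exact Nat.succ_pos _
        · exact Nat.succ_pos _
      · refine ⟨.inr (.inl b), hb.imp (congrArg _) (congrArg _), fun b' hb' => ?_⟩
        rcases e' with e' | e' <;> cases hb'
        exact Nat.succ_lt_succ (hd _ rfl)
    have hr : ∀ e' : Edge r, e = inRight e' →
        ∃ b, IsUpper (.node a l r) (some b) e ∧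
          ∀ b', e = .inl b' → depth (.node a l r) b < depth (.node a l r) b' := by
      rintro e' rfl
      rcases eq_leg_or_exists_isUpper r e' with rfl | ⟨b, hb, hd⟩
      · refine ⟨.inl (), .inr rfl, fun b' hb' => ?_⟩
        rcases b' with ⟨⟩ | b' | b'
        · cases h : leg r <;> rw [h] at hb' <;> cases hb'
        · exact Nat.succ_pos _
        · exact Nat.succ_pos _
      · refine ⟨.inr (.inr b), hb.imp (congrArg _) (congrArg _), fun b' hb' => ?_⟩
        rcases e' with e' | e' <;> cases hb'
        exact Nat.succ_lt_succ (hd _ rfl)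
    rcases e with (⟨⟩ | b | b) | (b | b)
    · exact .inl rfl
    · exact .inr (hl (.inl b) rfl)
    · exact .inr (hr (.inl b) rfl)
    · exact .inr (hl (.inr b) rfl)
    · exact .inr (hr (.inr b) rfl)

end BinTree

/-! ### Flows on a couple and their dimension -/

namespace Couple

variable (C : Couple)

/-- The leaves of the two trees of a couple. -/
abbrev Leaf : Type := Σ i, BinTree.Leaf (C.tree i)

theorem card_leaf : Fintype.card C.Leaf = C.numNodes + 2 := by
  simp only [numNodes, Fintype.card_sigma, Fin.sum_univ_two, BinTree.card_leaf]
  omega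

variable {C}

/-- In a connected couple some leaf of the first tree is paired with a leaf of the second one. -/
theorem IsConnected.exists_crossing (hC : C.IsConnected) :
    ∃ ℓ : C.Leaf, ℓ.1 = 0 ∧ (C.pair ℓ).1 = 1 := by
  by_contra! hno
  have hpair : ∀ ℓ : C.Leaf, (C.pair ℓ).1 = ℓ.1 := by
    intro ℓ
    -- Using the assumption at the leaf and at its partner rules out crossings in both directions.
    have h₁ := hno ℓ
    have h₂ := hno (C.pair ℓ)
    rw [C.pair_pair] at h₂
    generalize (C.pair ℓ).1 = i at *
    generalize ℓ.1 = j at *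
    fin_cases i <;> fin_cases j <;> simp_all
  have hinc : ∀ u e, C.Incident u e → u.1 = e.1 := by
    rintro u e ⟨i, w, f, rfl, rfl, -⟩
    rfl
  have hmer : ∀ e f, C.Merged e f → e.1 = f.1 := by
    rintro e f (rfl | ⟨ℓ, rfl, rfl⟩)
    · rfl
    · exact (hpair ℓ).symm
  have hadj : ∀ u v, C.graph.Adj u v → u.1 = v.1 := by
    rintro u v ⟨-, ⟨e, f, h, hu, hv⟩ | ⟨e, f, h, hu, hv⟩⟩
    · rw [hinc u e hu, hinc v f hv, hmer e f h]
    · rw [hinc u f hv, hinc v e hu, hmer e f h]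
  -- Without crossings the tree index is constant along walks, so the outer ends of the two legs
  -- cannot be joined.
  have hwalk : ∀ u v, C.graph.Walk u v → u.1 = v.1 := by
    intro u v w
    induction w with
    | nil => rfl
    | cons h _ ih => exact (hadj _ _ h).trans ih
  obtain ⟨w⟩ := hC.preconnected ⟨0, none⟩ ⟨1, none⟩
  exact absurd (hwalk _ _ w) (by simp)

variable (C)

/-- Conservation of momentum and the merging condition for families indexed by the tree edges. -/
structure IsFlow {M : Type*} [AddCommGroup M] (f : C.TreeEdge → M) : Prop where
  pair : ∀ ℓ, f (C.leafEdge ℓ) = -f (C.leafEdge (C.pair ℓ))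
  node : ∀ v, f (C.child₁ v) + f (C.child₂ v) - f (C.parent v) = 0

variable {C}

theorem IsFlow.leg_eq_sum {M : Type*} [AddCommGroup M] {f : C.TreeEdge → M} (hf : C.IsFlow f)
    (i : Fin 2) : f (C.leg i) = ∑ ℓ, f (C.leafEdge ⟨i, ℓ⟩) :=
  BinTree.apply_leg_eq_sum (C.tree i) (fun e => f ⟨i, e⟩) fun b => sub_eq_zero.1 (hf.node ⟨i, b⟩)

/-- Reindexing by the pairing shows that the sum over all leaves is its own negative, hence zero; it
is also the sum of the two legs. -/
theorem IsFlow.leg_zero_eq_neg {d : ℕ} {f : C.TreeEdge → EuclideanSpace ℝ (Fin d)}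
    (hf : C.IsFlow f) : f (C.leg 0) = -f (C.leg 1) := by
  have h : ∑ ℓ : C.Leaf, f (C.leafEdge ℓ) = -∑ ℓ : C.Leaf, f (C.leafEdge ℓ) := by
    rw [← Finset.sum_neg_distrib]
    exact Fintype.sum_equiv (Function.Involutive.toPerm C.pair C.pair_pair) _ _ hf.pair
  have h0 : ∑ ℓ : C.Leaf, f (C.leafEdge ℓ) = 0 := by
    have h2 : (2 : ℝ) • ∑ ℓ : C.Leaf, f (C.leafEdge ℓ) = 0 := by
      rw [two_smul]
      exact eq_neg_iff_add_eq_zero.1 h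
    exact (smul_eq_zero.1 h2).resolve_left two_ne_zero
  rw [Fintype.sum_sigma, Fin.sum_univ_two, ← hf.leg_eq_sum, ← hf.leg_eq_sum] at h0
  exact eq_neg_of_add_eq_zero_left h0

theorem IsFlow.eq_zero_of_leaf {M : Type*} [AddCommGroup M] {f : C.TreeEdge → M}
    (hf : C.IsFlow f) (h : ∀ ℓ, f (C.leafEdge ℓ) = 0) : f = 0 := by
  funext ⟨i, e⟩
  rcases e with b | ℓ
  · exact BinTree.eq_zero_of_leaf_eq_zero (C.tree i) (fun e => f ⟨i, e⟩)
      (fun b => sub_eq_zero.1 (hf.node ⟨i, b⟩)) (fun ℓ => h ⟨i, ℓ⟩) b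
  · exact h ⟨i, ℓ⟩

variable (C)

/-- The scalar flows which vanish on the legs and on all edges directly below the nodes in `S`. -/
def flows (S : Set C.Node) : Submodule ℝ (C.TreeEdge → ℝ) where
  carrier := {f | C.IsFlow f ∧ (∀ i, f (C.leg i) = 0) ∧
    ∀ v ∈ S, f (C.child₁ v) = 0 ∧ f (C.child₂ v) = 0}
  zero_mem' := ⟨⟨by simp, by simp⟩, by simp, by simp⟩
  add_mem' := by
    rintro f g ⟨⟨hf₁, hf₂⟩, hf₃, hf₄⟩ ⟨⟨hg₁, hg₂⟩, hg₃, hg₄⟩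
    refine ⟨⟨fun ℓ => ?_, fun v => ?_⟩, fun i => ?_, fun v hv => ⟨?_, ?_⟩⟩
    · simp only [Pi.add_apply, hf₁ ℓ, hg₁ ℓ]; ring
    · have h₁ := hf₂ v
      have h₂ := hg₂ v
      simp only [Pi.add_apply]; linarith
    · simp [hf₃, hg₃]
    · simp [(hf₄ v hv).1, (hg₄ v hv).1]
    · simp [(hf₄ v hv).2, (hg₄ v hv).2]
  smul_mem' := by
    rintro c f ⟨⟨hf₁, hf₂⟩, hf₃, hf₄⟩
    refine ⟨⟨fun ℓ => ?_, fun v => ?_⟩, fun i => ?_, fun v hv => ⟨?_, ?_⟩⟩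
    · simp only [Pi.smul_apply, hf₁ ℓ, smul_neg]
    · simp only [Pi.smul_apply, ← smul_add, ← smul_sub, hf₂ v, smul_zero]
    · simp [hf₃]
    · simp [(hf₄ v hv).1]
    · simp [(hf₄ v hv).2]

theorem flows_anti {S S' : Set C.Node} (h : S ⊆ S') : C.flows S' ≤ C.flows S :=
  fun _ hf => ⟨hf.1, hf.2.1, fun v hv => hf.2.2 v (h hv)⟩

/-- The functions on the leaves which are multiplied by `s` under the pairing. -/
def leafFunctions (s : ℝ) : Submodule ℝ (C.Leaf → ℝ) where
  carrier := {g | ∀ ℓ, g (C.pair ℓ) = s * g ℓ}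
  zero_mem' := by simp
  add_mem' := by
    intro f g hf hg ℓ
    simp only [Pi.add_apply, hf ℓ, hg ℓ, mul_add]
  smul_mem' := by
    intro c f hf ℓ
    simp only [Pi.smul_apply, hf ℓ, smul_eq_mul]
    ring

/-- Multiplication by a sign that is odd under the pairing embeds the odd functions into the even
ones. The two spaces meet only in zero, so twice the odd dimension fits into the number of leaves.
-/
theorem two_mul_finrank_leafFunctions_le :
    2 * Module.finrank ℝ (C.leafFunctions (-1)) ≤ C.numNodes + 2 := by
  let φ := Fintype.equivFin C.Leaf
  -- An arbitrary enumeration of the leaves selects one leaf from each pair.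
  let s : C.Leaf → ℝ := fun ℓ => if φ ℓ < φ (C.pair ℓ) then 1 else -1
  have hs : ∀ ℓ, s (C.pair ℓ) = -s ℓ := by
    intro ℓ
    have hne : φ (C.pair ℓ) ≠ φ ℓ := fun h => C.pair_ne ℓ (φ.injective h)
    simp only [s, C.pair_pair]
    rcases lt_or_gt_of_ne hne with h | h
    · rw [if_pos h, if_neg h.not_gt, neg_neg]
    · rw [if_pos h, if_neg h.not_gt]
  have hs0 : ∀ ℓ, s ℓ ≠ 0 := by
    intro ℓ
    simp only [s]
    split_ifs <;> norm_num
  let m : (C.Leaf → ℝ) →ₗ[ℝ] (C.Leaf → ℝ) := LinearMap.mulLeft ℝ s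
  have hm : ∀ g ∈ C.leafFunctions (-1), m g ∈ C.leafFunctions 1 := by
    intro g hg ℓ
    have h := hg ℓ
    simp only [m, LinearMap.mulLeft_apply, Pi.mul_apply, hs, h]
    ring
  have h₁ : Module.finrank ℝ (C.leafFunctions (-1)) ≤ Module.finrank ℝ (C.leafFunctions 1) := by
    refine LinearMap.finrank_le_finrank_of_injective (f := m.restrict hm) ?_
    rintro ⟨g, hg⟩ ⟨g', hg'⟩ h
    have h' : s * g = s * g' := congrArg Subtype.val h
    refine Subtype.ext (funext fun ℓ => ?_)
    exact mul_left_cancel₀ (hs0 ℓ) (congrFun h' ℓ)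
  have h₂ : C.leafFunctions (-1) ⊓ C.leafFunctions 1 = ⊥ := by
    refine (Submodule.eq_bot_iff _).2 fun g hg => funext fun ℓ => ?_
    have h₁ := hg.1 ℓ
    have h₂ := hg.2 ℓ
    simp only [Pi.zero_apply]
    linarith
  have h₃ := Submodule.finrank_sup_add_finrank_inf_eq (C.leafFunctions (-1)) (C.leafFunctions 1)
  have h₄ := Submodule.finrank_le (C.leafFunctions (-1) ⊔ C.leafFunctions 1)
  rw [Module.finrank_fintype_fun_eq_card, C.card_leaf] at h₄
  rw [h₂, finrank_bot] at h₃
  omega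

variable {C}

/-- Restriction to the leaves is injective on flows and lands in the odd functions with zero sum
over the first tree. A crossing pair makes this a proper subspace, which turns `n + 2` into `n`. -/
theorem IsConnected.two_mul_finrank_flows_le (hC : C.IsConnected) :
    2 * Module.finrank ℝ (C.flows ∅) ≤ C.numNodes := by
  classical
  let tot : (C.Leaf → ℝ) →ₗ[ℝ] ℝ :=
    ∑ ℓ : BinTree.Leaf (C.tree 0), LinearMap.proj (⟨0, ℓ⟩ : C.Leaf)
  have htot : ∀ g, tot g = ∑ ℓ, g ⟨0, ℓ⟩ := fun g => by simp [tot]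
  let W := C.leafFunctions (-1) ⊓ LinearMap.ker tot
  have hlt : W < C.leafFunctions (-1) := by
    refine lt_of_le_of_ne inf_le_left fun heq => ?_
    obtain ⟨⟨i, ℓ⟩, hi, hp⟩ := hC.exists_crossing
    obtain rfl : i = 0 := hi
    -- Only the first of the two point masses lies in the first tree, so this odd function has sum
    -- one there.
    let g : C.Leaf → ℝ := Pi.single ⟨0, ℓ⟩ 1 - Pi.single (C.pair ⟨0, ℓ⟩) 1
    have hg : g ∈ C.leafFunctions (-1) := by
      intro x
      have e₁ : C.pair x = ⟨0, ℓ⟩ ↔ x = C.pair ⟨0, ℓ⟩ :=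
        ⟨fun h => by rw [← h, C.pair_pair], fun h => by rw [h, C.pair_pair]⟩
      have e₂ : C.pair x = C.pair ⟨0, ℓ⟩ ↔ x = ⟨0, ℓ⟩ :=
        ⟨fun h => by rw [← C.pair_pair x, h, C.pair_pair], fun h => by rw [h]⟩
      simp only [g, Pi.sub_apply, Pi.single_apply, e₁, e₂]
      ring
    rw [← heq] at hg
    have h0 : tot g = 0 := hg.2
    have hne : ∀ x : BinTree.Leaf (C.tree 0), (⟨0, x⟩ : C.Leaf) ≠ C.pair ⟨0, ℓ⟩ := by
      intro x hx
      rw [← hx] at hp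
      exact absurd hp (by simp)
    have h1 : tot g = 1 := by
      rw [htot, Finset.sum_eq_single ℓ]
      · simp [g, hne]
      · intro b _ hb
        have : (⟨0, b⟩ : C.Leaf) ≠ ⟨0, ℓ⟩ := fun h => hb (eq_of_heq (Sigma.mk.inj h).2)
        simp [g, hne, this]
      · simp
    rw [h1] at h0
    exact one_ne_zero h0
  have h₁ := Submodule.finrank_lt_finrank_of_lt hlt
  let r : (C.TreeEdge → ℝ) →ₗ[ℝ] (C.Leaf → ℝ) := LinearMap.funLeft ℝ ℝ C.leafEdge
  have hr : ∀ f ∈ C.flows ∅, r f ∈ W := by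
    intro f hf
    refine ⟨fun ℓ => ?_, ?_⟩
    · have h := hf.1.pair ℓ
      simp only [r, LinearMap.funLeft_apply, h]
      ring
    · change tot (r f) = 0
      rw [htot]
      exact (hf.1.leg_eq_sum 0).symm.trans (hf.2.1 0)
  have h₂ : Module.finrank ℝ (C.flows ∅) ≤ Module.finrank ℝ W := by
    refine LinearMap.finrank_le_finrank_of_injective (f := r.restrict hr) ?_
    rw [← LinearMap.ker_eq_bot, LinearMap.ker_eq_bot']
    rintro ⟨f, hf⟩ h
    have h' : r f = 0 := congrArg Subtype.val h
    exact Subtype.ext (hf.1.eq_zero_of_leaf fun ℓ => congrFun h' ℓ)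
  have h₃ := C.two_mul_finrank_leafFunctions_le
  omega

/-! ### Counting by descent -/

/-- A family with prescribed legs is counted by descending the trees: a node whose upper edge is
known costs a factor only if its lower edges are not determined by linear relations, and this
happens as often as the dimension of the space of flows says. -/
theorem card_le_pow_finrank_flows {d : ℕ} (C : Couple) (w : C.Node → ℝ) (B : ℝ) (hB : 1 ≤ B)
    (hw : ∀ v, 1 ≤ w v) (sol : Set (C.TreeEdge → EuclideanSpace ℝ (Fin d)))
    (hdiff : ∀ k ∈ sol, ∀ k' ∈ sol, ∀ i, (fun e => k e i - k' e i) ∈ C.flows ∅)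
    (hstep : ∀ v a (X : Finset (EuclideanSpace ℝ (Fin d))),
      (∀ x ∈ X, ∃ k ∈ sol, k (C.parent v) = a ∧ k (C.child₁ v) = x) → (X.card : ℝ) ≤ B * w v)
    (F : Finset (C.TreeEdge → EuclideanSpace ℝ (Fin d))) (hF : ∀ k ∈ F, k ∈ sol) :
    (F.card : ℝ) ≤ B ^ Module.finrank ℝ (C.flows ∅) * ∏ v, w v := by
  classical
  suffices H : ∀ (n : ℕ) (S : Finset C.Node), Sᶜ.card = n →
      ∀ F : Finset (C.TreeEdge → EuclideanSpace ℝ (Fin d)), (∀ k ∈ F, k ∈ sol) →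
      (∀ k ∈ F, ∀ k' ∈ F, ∀ v ∈ S, k (C.child₁ v) = k' (C.child₁ v) ∧
        k (C.child₂ v) = k' (C.child₂ v)) →
      (F.card : ℝ) ≤ B ^ Module.finrank ℝ (C.flows (S : Set C.Node)) * ∏ v ∈ Sᶜ, w v by
    -- `S` is the set of processed nodes: all families under consideration agree on the edges below
    -- them.
    have h := H _ ∅ rfl F hF (by simp)
    rwa [Finset.coe_empty, Finset.compl_empty] at h
  have hleg : ∀ k ∈ sol, ∀ k' ∈ sol, ∀ i, k (C.leg i) = k' (C.leg i) := by
    intro k hk k' hk' i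
    ext j
    exact sub_eq_zero.1 ((hdiff k hk k' hk' j).2.1 i)
  have hcons : ∀ k ∈ sol, ∀ k' ∈ sol, ∀ v, k (C.parent v) = k' (C.parent v) →
      k (C.child₁ v) = k' (C.child₁ v) → k (C.child₂ v) = k' (C.child₂ v) := by
    intro k hk k' hk' v h₁ h₂
    ext j
    have h := (hdiff k hk k' hk' j).1.node v
    simp only [h₁, h₂] at h
    linarith
  intro n
  induction n with
  | zero =>
    intro S hS F hF hag
    have hS' : ∀ v, v ∈ S := by
      rw [Finset.card_eq_zero, Finset.compl_eq_empty_iff] at hS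
      simp [hS]
    have h1 : F.card ≤ 1 := by
      refine Finset.card_le_one.2 fun k hk k' hk' => funext fun ⟨i, e⟩ => ?_
      rcases BinTree.eq_leg_or_exists_isUpper (C.tree i) e with rfl | ⟨b, h | h, -⟩
      · exact hleg k (hF k hk) k' (hF k' hk') i
      · rw [h]; exact (hag k hk k' hk' ⟨i, b⟩ (hS' _)).1
      · rw [h]; exact (hag k hk k' hk' ⟨i, b⟩ (hS' _)).2
    rw [Finset.card_eq_zero.1 hS, Finset.prod_empty, mul_one]
    exact le_trans (by exact_mod_cast h1) (one_le_pow₀ hB)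
  | succ n ih =>
    intro S hS F hF hag
    have hne : (Sᶜ).Nonempty := Finset.card_pos.1 (by omega)
    obtain ⟨v, hv, hmin⟩ :=
      Finset.exists_min_image Sᶜ (fun v => BinTree.depth (C.tree v.1) v.2) hne
    have hpar : ∀ k ∈ F, ∀ k' ∈ F, k (C.parent v) = k' (C.parent v) := by
      intro k hk k' hk'
      obtain ⟨i, b⟩ := v
      rcases BinTree.eq_leg_or_exists_isUpper (C.tree i) (.inl b) with h | ⟨b', h, hd⟩
      · have h' : C.parent ⟨i, b⟩ = C.leg i := by rw [parent, h]; rfl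
        rw [h']
        exact hleg k (hF k hk) k' (hF k' hk') i
      · have hmem : (⟨i, b'⟩ : C.Node) ∈ S := by
          by_contra hn
          exact absurd (hmin ⟨i, b'⟩ (Finset.mem_compl.2 hn)) (not_le.2 (hd b rfl))
        rcases h with h | h
        · have h' : C.parent ⟨i, b⟩ = C.child₁ ⟨i, b'⟩ := by rw [parent, h]; rfl
          rw [h']
          exact (hag k hk k' hk' _ hmem).1
        · have h' : C.parent ⟨i, b⟩ = C.child₂ ⟨i, b'⟩ := by rw [parent, h]; rfl
          rw [h']
          exact (hag k hk k' hk' _ hmem).2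
    have hprod : ∏ u ∈ Sᶜ, w u = w v * ∏ u ∈ (insert v S)ᶜ, w u := by
      rw [Finset.compl_insert, Finset.mul_prod_erase _ _ hv]
    have hcard : ((insert v S)ᶜ).card = n := by
      rw [Finset.compl_insert, Finset.card_erase_of_mem hv, hS]; rfl
    have hsub : (S : Set C.Node) ⊆ (insert v S : Finset C.Node) := by simp
    have hpos : 0 ≤ ∏ u ∈ (insert v S)ᶜ, w u :=
      Finset.prod_nonneg fun u _ => zero_le_one.trans (hw u)
    have hB0 : 0 ≤ B := zero_le_one.trans hB
    rw [hprod]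
    -- If the space does not shrink, every difference of two families already vanishes below `v`, so
    -- `v` costs nothing. Otherwise the dimension drops by at least one, which pays for one factor
    -- `B`.
    by_cases heq : C.flows (insert v S : Finset C.Node) = C.flows (S : Set C.Node)
    · have h := ih (insert v S) hcard F hF (by
        intro k hk k' hk' u hu
        have hmem : ∀ i, (fun e => k e i - k' e i) ∈ C.flows (insert v S : Finset C.Node) := by
          intro i
          rw [heq]
          have h0 := hdiff k (hF k hk) k' (hF k' hk') i
          refine ⟨h0.1, h0.2.1, fun u hu => ?_⟩
          have := hag k hk k' hk' u hu
          simp [this.1, this.2]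
        constructor
        · ext i
          exact sub_eq_zero.1 ((hmem i).2.2 u hu).1
        · ext i
          exact sub_eq_zero.1 ((hmem i).2.2 u hu).2)
      rw [heq] at h
      refine h.trans (mul_le_mul_of_nonneg_left ?_ (pow_nonneg hB0 _))
      exact le_mul_of_one_le_left hpos (hw v)
    · have hlt : C.flows (insert v S : Finset C.Node) < C.flows (S : Set C.Node) :=
        lt_of_le_of_ne (C.flows_anti hsub) heq
      have hrank := Submodule.finrank_lt_finrank_of_lt hlt
      rcases F.eq_empty_or_nonempty with rfl | ⟨k₀, hk₀⟩
      · simp only [Finset.card_empty, Nat.cast_zero]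
        have := zero_le_one.trans (hw v)
        positivity
      set X := F.image fun k => k (C.child₁ v) with hX
      have hXcard : (X.card : ℝ) ≤ B * w v := by
        refine hstep v (k₀ (C.parent v)) X fun x hx => ?_
        obtain ⟨k, hk, rfl⟩ := Finset.mem_image.1 hx
        exact ⟨k, hF k hk, hpar k hk k₀ hk₀, rfl⟩
      have hfib : ∀ x ∈ X, ((F.filter fun k => k (C.child₁ v) = x).card : ℝ) ≤
          B ^ Module.finrank ℝ (C.flows (insert v S : Finset C.Node)) *
            ∏ u ∈ (insert v S)ᶜ, w u := by
        intro x _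
        refine ih (insert v S) hcard _ (fun k hk => hF k (Finset.mem_filter.1 hk).1) ?_
        intro k hk k' hk' u hu
        rw [Finset.mem_filter] at hk hk'
        obtain ⟨hk, hkx⟩ := hk
        obtain ⟨hk', hkx'⟩ := hk'
        rcases Finset.mem_insert.1 hu with rfl | hu
        · have h₁ := hkx.trans hkx'.symm
          exact ⟨h₁, hcons k (hF k hk) k' (hF k' hk') u (hpar k hk k' hk') h₁⟩
        · exact hag k hk k' hk' u hu
      have hsum : (F.card : ℝ) = ∑ x ∈ X, ((F.filter fun k => k (C.child₁ v) = x).card : ℝ) := by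
        exact_mod_cast Finset.card_eq_sum_card_image (fun k => k (C.child₁ v)) F
      rw [hsum]
      refine (Finset.sum_le_card_nsmul _ _ _ hfib).trans ?_
      rw [nsmul_eq_mul]
      set D := Module.finrank ℝ (C.flows (insert v S : Finset C.Node))
      calc (X.card : ℝ) * (B ^ D * ∏ u ∈ (insert v S)ᶜ, w u)
          ≤ (B * w v) * (B ^ D * ∏ u ∈ (insert v S)ᶜ, w u) :=
            mul_le_mul_of_nonneg_right hXcard (by positivity)
        _ = B ^ (D + 1) * (w v * ∏ u ∈ (insert v S)ᶜ, w u) := by ring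
        _ ≤ _ := by
            have := zero_le_one.trans (hw v)
            exact mul_le_mul_of_nonneg_right (pow_le_pow_right₀ hB hrank) (by positivity)

end Couple

/-! ### Integer points in planar annuli -/

namespace ZK

theorem sum_inv_one_add_abs_le (n : ℕ) :
    ∑ m ∈ Finset.Icc (-n : ℤ) n, (1 + |(m : ℝ)|)⁻¹ ≤ 2 * (1 + Real.log (n + 1)) := by
  classical
  have hH : ∑ j ∈ Finset.range (n + 1), (1 + (j : ℝ))⁻¹ ≤ 1 + Real.log (n + 1) := by
    have h := harmonic_le_one_add_log (n + 1)
    rw [harmonic] at h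
    push_cast at h
    refine le_trans (le_of_eq ?_) h
    exact Finset.sum_congr rfl fun j _ => by rw [add_comm]
  have hsub : Finset.Icc (-n : ℤ) n ⊆ (Finset.range (n + 1)).image (fun j : ℕ => (j : ℤ)) ∪
      (Finset.range (n + 1)).image (fun j : ℕ => -(j : ℤ)) := by
    intro m hm
    rw [Finset.mem_Icc] at hm
    simp only [Finset.mem_union, Finset.mem_image, Finset.mem_range]
    rcases le_total 0 m with h | h
    · exact .inl ⟨m.toNat, by omega, by omega⟩
    · exact .inr ⟨(-m).toNat, by omega, by omega⟩
  have hnn : ∀ m : ℤ, 0 ≤ (1 + |(m : ℝ)|)⁻¹ := fun m => by positivity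
  calc ∑ m ∈ Finset.Icc (-n : ℤ) n, (1 + |(m : ℝ)|)⁻¹
      ≤ _ := Finset.sum_le_sum_of_subset_of_nonneg hsub fun m _ _ => hnn m
    _ ≤ ∑ m ∈ (Finset.range (n + 1)).image (fun j : ℕ => (j : ℤ)), (1 + |(m : ℝ)|)⁻¹ +
        ∑ m ∈ (Finset.range (n + 1)).image (fun j : ℕ => -(j : ℤ)), (1 + |(m : ℝ)|)⁻¹ := by
        rw [← Finset.sum_union_inter]
        exact le_add_of_nonneg_right (Finset.sum_nonneg fun m _ => hnn m)
    _ = ∑ j ∈ Finset.range (n + 1), (1 + (j : ℝ))⁻¹ +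
        ∑ j ∈ Finset.range (n + 1), (1 + (j : ℝ))⁻¹ := by
        rw [Finset.sum_image (fun a _ b _ h => by simpa using h),
          Finset.sum_image (fun a _ b _ h => by simpa using h)]
        simp
    _ ≤ _ := by linarith

theorem sum_inv_one_add_abs_sub_le (N : ℕ) (p : ℝ) :
    ∑ Y ∈ Finset.Icc (-N : ℤ) N, (1 + |(Y : ℝ) - p|)⁻¹ ≤ 4 * (1 + Real.log (2 * N + 1)) := by
  -- Clamping the center to the range of summation brings it no farther from any `Y` and keeps the
  -- bound independent of `p`.
  set q : ℤ := max (-N) (min N ⌊p⌋) with hq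
  have hterm : ∀ Y ∈ Finset.Icc (-N : ℤ) N,
      (1 + |(Y : ℝ) - p|)⁻¹ ≤ 2 * (1 + |((Y - q : ℤ) : ℝ)|)⁻¹ := by
    intro Y hY
    rw [Finset.mem_Icc] at hY
    have h₁ : |Y - q| ≤ |Y - ⌊p⌋| := by
      rw [hq]
      rcases abs_cases (Y - max (-N : ℤ) (min N ⌊p⌋)) with h | h <;>
        rcases abs_cases (Y - ⌊p⌋) with h' | h' <;> omega
    have h₂ : |((Y - q : ℤ) : ℝ)| ≤ |(Y : ℝ) - p| + 1 := by
      have h₃ : |((Y - q : ℤ) : ℝ)| ≤ |(Y : ℝ) - ⌊p⌋| := by exact_mod_cast h₁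
      have h₄ : |(p : ℝ) - ⌊p⌋| ≤ 1 := by
        rw [abs_le]
        constructor <;> linarith [Int.floor_le p, Int.lt_floor_add_one p]
      have h₅ := abs_add_le ((Y : ℝ) - p) (p - ⌊p⌋)
      rw [sub_add_sub_cancel] at h₅
      linarith
    have h₃ := abs_nonneg ((Y : ℝ) - p)
    have h₄ := abs_nonneg ((Y - q : ℤ) : ℝ)
    rw [← div_eq_mul_inv, inv_eq_one_div, div_le_div_iff₀ (by linarith) (by linarith)]
    linarith
  have hlog := sum_inv_one_add_abs_le (2 * N)
  push_cast at hlog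
  have hshift : ∑ Y ∈ Finset.Icc (-N : ℤ) N, (1 + |((Y - q : ℤ) : ℝ)|)⁻¹ ≤
      ∑ m ∈ Finset.Icc (-(2 * N) : ℤ) (2 * N), (1 + |(m : ℝ)|)⁻¹ := by
    rw [← Finset.sum_image (s := Finset.Icc (-N : ℤ) N) (g := fun Y => Y - q)
      (f := fun m : ℤ => (1 + |(m : ℝ)|)⁻¹) (fun a _ b _ h => by simpa using h)]
    refine Finset.sum_le_sum_of_subset_of_nonneg ?_ fun m _ _ => by positivity
    intro m hm
    obtain ⟨Y, hY, rfl⟩ := Finset.mem_image.1 hm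
    rw [Finset.mem_Icc] at hY ⊢
    omega
  refine (Finset.sum_le_sum hterm).trans ?_
  rw [← Finset.mul_sum]
  linarith

theorem card_int_le_of_sub_le (S : Finset ℤ) (D : ℝ) (hD : 0 ≤ D)
    (h : ∀ a ∈ S, ∀ b ∈ S, ((b : ℝ) - a) ≤ D) : (S.card : ℝ) ≤ D + 1 := by
  rcases S.eq_empty_or_nonempty with rfl | hS
  · simp; linarith
  have hsub : S ⊆ Finset.Icc (S.min' hS) (S.max' hS) := fun x hx =>
    Finset.mem_Icc.2 ⟨S.min'_le x hx, S.le_max' x hx⟩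
  have h₁ := Finset.card_le_card hsub
  rw [Int.card_Icc] at h₁
  have h₂ := h _ (S.min'_mem hS) _ (S.max'_mem hS)
  have h₃ : S.min' hS ≤ S.max' hS := S.min'_le _ (S.max'_mem hS)
  have h₄ : (S.card : ℤ) ≤ S.max' hS + 1 - S.min' hS := by omega
  have h₅ : (S.card : ℝ) ≤ S.max' hS + 1 - S.min' hS := by exact_mod_cast h₄
  linarith

/-- Integers in a one-dimensional annulus, on one side of the center. -/
theorem card_int_annulus_le (S : Finset ℤ) (q u B R : ℝ) (hR : 0 ≤ R) (hu : 0 ≤ u)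
    (hS : ∀ z ∈ S, u ≤ z - q ∧ |((z : ℝ) - q) ^ 2 - B| ≤ R) :
    (S.card : ℝ) ≤ 3 * R * (1 + u)⁻¹ + 1 := by
  refine card_int_le_of_sub_le S _ (by positivity) fun a ha b hb => ?_
  obtain ⟨ha₁, ha₂⟩ := hS a ha
  obtain ⟨hb₁, hb₂⟩ := hS b hb
  rcases le_or_gt b a with hab | hab
  · have : (b : ℝ) ≤ a := by exact_mod_cast hab
    have : 0 ≤ 3 * R * (1 + u)⁻¹ := by positivity
    linarith
  have hab' : (a : ℝ) + 1 ≤ b := by exact_mod_cast hab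
  rw [abs_le] at ha₂ hb₂
  rw [← div_eq_mul_inv, le_div_iff₀ (by linarith)]
  -- The second factor is at least `2 * u` and at least `1`; adding the two resulting bounds gives
  -- `(b - a) * (1 + u) ≤ 3 * R`.
  have h₁ : ((b : ℝ) - a) * (b + a - 2 * q) ≤ 2 * R := by nlinarith
  have h₂ : ((b : ℝ) - a) * (2 * u) ≤ ((b : ℝ) - a) * (b + a - 2 * q) :=
    mul_le_mul_of_nonneg_left (by linarith) (by linarith)
  have h₃ : ((b : ℝ) - a) * 1 ≤ ((b : ℝ) - a) * (b + a - 2 * q) :=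
    mul_le_mul_of_nonneg_left (by linarith) (by linarith)
  nlinarith

/-- Slicing along the coordinate closer to the center keeps the other one at distance at least `|Y -
p|`, away from the tangential part of the annulus. Each slice has two sides, and the sum of `(1 + |Y
- p|)⁻¹` is only logarithmic. -/
theorem card_annulus_half_le (S : Finset (ℤ × ℤ)) (N : ℕ) (p q A R : ℝ) (hR : 0 ≤ R)
    (hN : ∀ s ∈ S, |s.1| ≤ N) (hpq : ∀ s ∈ S, |(s.1 : ℝ) - p| ≤ |(s.2 : ℝ) - q|)
    (hS : ∀ s ∈ S, |((s.1 : ℝ) - p) ^ 2 + ((s.2 : ℝ) - q) ^ 2 - A| ≤ R) :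
    (S.card : ℝ) ≤ 2 * (2 * N + 1) + 24 * R * (1 + Real.log (2 * N + 1)) := by
  classical
  have hmaps : ∀ s ∈ S, s.1 ∈ Finset.Icc (-N : ℤ) N := fun s hs =>
    Finset.mem_Icc.2 (abs_le.1 (hN s hs))
  have hfib : ∀ Y ∈ Finset.Icc (-N : ℤ) N, ((S.filter fun s => s.1 = Y).card : ℝ) ≤
      2 + 6 * R * (1 + |(Y : ℝ) - p|)⁻¹ := by
    intro Y _
    set T := (S.filter fun s => s.1 = Y).image Prod.snd with hT
    have hcard : (S.filter fun s => s.1 = Y).card = T.card := by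
      refine (Finset.card_image_of_injOn ?_).symm
      intro s hs t ht hst
      have h₁ := (Finset.mem_filter.1 hs).2
      have h₂ := (Finset.mem_filter.1 ht).2
      exact Prod.ext (h₁.trans h₂.symm) hst
    have hmem : ∀ z ∈ T, |(Y : ℝ) - p| ≤ |(z : ℝ) - q| ∧
        |((z : ℝ) - q) ^ 2 - (A - ((Y : ℝ) - p) ^ 2)| ≤ R := by
      intro z hz
      obtain ⟨s, hs, rfl⟩ := Finset.mem_image.1 hz
      rw [Finset.mem_filter] at hs
      obtain ⟨hs, rfl⟩ := hs
      refine ⟨hpq s hs, ?_⟩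
      have h := hS s hs
      rwa [show ((s.2 : ℝ) - q) ^ 2 - (A - ((s.1 : ℝ) - p) ^ 2) =
        ((s.1 : ℝ) - p) ^ 2 + ((s.2 : ℝ) - q) ^ 2 - A by ring]
    have h₁ := card_int_annulus_le (T.filter fun z : ℤ => q ≤ z) q |(Y : ℝ) - p|
      (A - ((Y : ℝ) - p) ^ 2) R hR (abs_nonneg _) (by
        intro z hz
        obtain ⟨hz, hzq⟩ := Finset.mem_filter.1 hz
        have h := hmem z hz
        rw [abs_of_nonneg (sub_nonneg.2 hzq)] at h
        exact h)
    have h₂ := card_int_annulus_le ((T.filter fun z : ℤ => ¬ q ≤ z).image fun z => -z) (-q)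
      |(Y : ℝ) - p| (A - ((Y : ℝ) - p) ^ 2) R hR (abs_nonneg _) (by
        intro z hz
        obtain ⟨y, hy, rfl⟩ := Finset.mem_image.1 hz
        obtain ⟨hy, hyq⟩ := Finset.mem_filter.1 hy
        have h := hmem y hy
        rw [abs_of_neg (sub_neg.2 (not_le.1 hyq))] at h
        push_cast
        refine ⟨by linarith [h.1], ?_⟩
        rw [show (-(y : ℝ) - -q) ^ 2 = ((y : ℝ) - q) ^ 2 by ring]
        exact h.2)
    rw [Finset.card_image_of_injective _ neg_injective] at h₂
    have h₃ : (T.card : ℝ) = (T.filter fun z : ℤ => q ≤ z).card +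
        (T.filter fun z : ℤ => ¬ q ≤ z).card := by
      exact_mod_cast (Finset.card_filter_add_card_filter_not _).symm
    rw [hcard, h₃]
    linarith
  have hsum : (S.card : ℝ) =
      ∑ Y ∈ Finset.Icc (-N : ℤ) N, ((S.filter fun s => s.1 = Y).card : ℝ) := by
    exact_mod_cast Finset.card_eq_sum_card_fiberwise hmaps
  have h := sum_inv_one_add_abs_sub_le N p
  have hc : ((Finset.Icc (-N : ℤ) N).card : ℝ) = 2 * N + 1 := by
    have : (Finset.Icc (-N : ℤ) N).card = 2 * N + 1 := by rw [Int.card_Icc]; omega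
    rw [this]; push_cast; ring
  rw [hsum]
  refine (Finset.sum_le_sum hfib).trans ?_
  rw [Finset.sum_add_distrib, Finset.sum_const, nsmul_eq_mul, hc, ← Finset.mul_sum]
  have := mul_le_mul_of_nonneg_left h (by positivity : 0 ≤ 6 * R)
  linarith

/-- Lattice points of a box in a planar annulus with arbitrary center. -/
theorem card_annulus_le (S : Finset (ℤ × ℤ)) (N : ℕ) (p q A R : ℝ) (hR : 0 ≤ R)
    (hN : ∀ s ∈ S, |s.1| ≤ N ∧ |s.2| ≤ N)
    (hS : ∀ s ∈ S, |((s.1 : ℝ) - p) ^ 2 + ((s.2 : ℝ) - q) ^ 2 - A| ≤ R) :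
    (S.card : ℝ) ≤ 4 * (2 * N + 1) + 48 * R * (1 + Real.log (2 * N + 1)) := by
  classical
  let P : ℤ × ℤ → Prop := fun s => |(s.1 : ℝ) - p| ≤ |(s.2 : ℝ) - q|
  have h₁ := card_annulus_half_le (S.filter P) N p q A R hR
    (fun s hs => (hN s (Finset.mem_filter.1 hs).1).1) (fun s hs => (Finset.mem_filter.1 hs).2)
    (fun s hs => hS s (Finset.mem_filter.1 hs).1)
  have hsw : ∀ s ∈ (S.filter fun s => ¬ P s).image Prod.swap, s.swap ∈ S ∧ ¬ P s.swap := by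
    intro s hs
    obtain ⟨t, ht, rfl⟩ := Finset.mem_image.1 hs
    exact Finset.mem_filter.1 ht
  have h₂ := card_annulus_half_le ((S.filter fun s => ¬ P s).image Prod.swap) N q p A R hR
    (fun s hs => (hN _ (hsw s hs).1).2) (fun s hs => (not_le.1 (hsw s hs).2).le)
    (fun s hs => by
      have h := hS _ (hsw s hs).1
      simp only [Prod.fst_swap, Prod.snd_swap] at h
      rwa [add_comm] at h)
  rw [Finset.card_image_of_injective _ Prod.swap_injective] at h₂
  have h₃ : (S.card : ℝ) = (S.filter P).card + (S.filter fun s => ¬ P s).card := by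
    exact_mod_cast (Finset.card_filter_add_card_filter_not _).symm
  rw [h₃]
  linarith

/-! ### The count at a single node -/

/-- The number of ways to split a given momentum at a node, with an energy window of width `τ`. -/
theorem card_node_le {d : ℕ} [NeZero d] (hd : 3 ≤ d) {c₀ c₁ : ℝ} (hc₀ : 0 < c₀) (hc₁ : 0 < c₁) :
    ∃ K : ℝ, 0 < K ∧ ∀ L : ℝ, 1 ≤ L → ∀ τ : ℝ, c₁ / L ≤ τ → ∀ κ : ℝ, 0 < κ → κ ≤ 1 →
      ∀ a : EuclideanSpace ℝ (Fin d), κ / 2 ≤ |xcoord a| → ∀ σ : ℝ,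
      ∀ X : Finset (EuclideanSpace ℝ (Fin d)),
        (∀ x ∈ X, x ∈ lattice d L ∧ ‖x‖ ≤ c₀ ∧ |Lam x + Lam (a - x) - Lam a - σ| ≤ τ) →
        (X.card : ℝ) ≤ K * (1 + Real.log L) * (L ^ d * τ / κ) := by
  classical
  set b : ℝ := 2 * c₀ + 1 with hb
  have hb1 : 1 ≤ b := by linarith
  have hlogb : 0 ≤ Real.log b := Real.log_nonneg hb1
  refine ⟨b ^ (d - 2) * 2 * (2 * b / c₁ + 48 * (1 + Real.log b)), by positivity, ?_⟩
  intro L hL τ hτ κ hκ hκ1 a ha σ X hX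
  have hL0 : 0 < L := by linarith
  have hlogL : 0 ≤ Real.log L := Real.log_nonneg hL
  have hτ0 : 0 < τ := lt_of_lt_of_le (by positivity) hτ
  set R : ℝ := 2 * τ * L ^ 2 / κ with hR
  have hR0 : 0 < R := by positivity
  set N : ℕ := ⌊c₀ * L⌋₊ with hN
  have hNb : (2 * N + 1 : ℝ) ≤ b * L := by
    have := Nat.floor_le (a := c₀ * L) (by positivity)
    rw [hb]; linarith
  let Z : EuclideanSpace ℝ (Fin d) → Fin d → ℤ := fun x i => round (x i * L)
  have hZ : ∀ x ∈ X, ∀ i, (Z x i : ℝ) = x i * L := by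
    intro x hx i
    obtain ⟨k, hk⟩ := (hX x hx).1
    simp only [Z, hk i, div_mul_cancel₀ _ hL0.ne', round_intCast]
  have hZN : ∀ x ∈ X, ∀ i, |Z x i| ≤ N := by
    intro x hx i
    have h₁ : |x i| ≤ c₀ := (PiLp.norm_apply_le x i).trans (hX x hx).2.1
    have h₂ : |(Z x i : ℝ)| ≤ c₀ * L := by
      rw [hZ x hx i, abs_mul, abs_of_pos hL0]
      exact mul_le_mul_of_nonneg_right h₁ hL0.le
    have h₃ : (Z x i).natAbs ≤ N := Nat.le_floor (by rw [Nat.cast_natAbs]; exact_mod_cast h₂)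
    rw [Int.abs_eq_natAbs]
    exact_mod_cast h₃
  -- Here `d ≥ 3` enters: two coordinates other than the first are left free.
  let i₁ : Fin d := ⟨1, by omega⟩
  let i₂ : Fin d := ⟨2, by omega⟩
  have h12 : i₁ ≠ i₂ := by simp [i₁, i₂]
  have h01 : (0 : Fin d) ≠ i₁ := by simp [i₁, Fin.ext_iff]
  have h02 : (0 : Fin d) ≠ i₂ := by simp [i₂, Fin.ext_iff]
  let J := {i : Fin d // i ≠ i₁ ∧ i ≠ i₂}
  have hJ : Fintype.card J = d - 2 := by
    have h : (Finset.univ.filter fun i : Fin d => i ≠ i₁ ∧ i ≠ i₂) = {i₁, i₂}ᶜ := by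
      ext i; simp
    rw [Fintype.card_subtype, h, Finset.card_compl, Finset.card_pair h12, Fintype.card_fin]
  let rest : EuclideanSpace ℝ (Fin d) → ℝ := fun x => ∑ j : J, x j.1 ^ 2
  have hsq : ∀ x : EuclideanSpace ℝ (Fin d), ∑ i, x i ^ 2 = x i₁ ^ 2 + x i₂ ^ 2 + rest x := by
    intro x
    have h : (Finset.univ.filter fun i : Fin d => i ≠ i₁ ∧ i ≠ i₂) = {i₁, i₂}ᶜ := by
      ext i; simp
    rw [← Finset.sum_add_sum_compl {i₁, i₂}, Finset.sum_pair h12, ← h]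
    congr 1
    exact Finset.sum_subtype _ (by simp) _
  let φ : EuclideanSpace ℝ (Fin d) → J → ℤ := fun x j => Z x j.1
  let T : Finset (J → ℤ) := Fintype.piFinset fun _ => Finset.Icc (-N : ℤ) N
  have hT : (T.card : ℝ) = (2 * N + 1) ^ (d - 2) := by
    have h : (Finset.Icc (-N : ℤ) N).card = 2 * N + 1 := by rw [Int.card_Icc]; omega
    rw [Fintype.card_piFinset, Finset.prod_const, Finset.card_univ, hJ, h]
    push_cast; ring
  set M : ℝ := 4 * (2 * N + 1) + 48 * R * (1 + Real.log (2 * N + 1)) with hM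
  have hfib : ∀ t ∈ T, ((X.filter fun x => φ x = t).card : ℝ) ≤ M := by
    intro t _
    have hmem : ∀ x ∈ X.filter (fun x => φ x = t), x ∈ X ∧ ∀ j : J, x j.1 = t j / L := by
      intro x hx
      rw [Finset.mem_filter] at hx
      obtain ⟨hx, rfl⟩ := hx
      refine ⟨hx, fun j => ?_⟩
      rw [eq_div_iff hL0.ne']
      exact (hZ x hx j.1).symm
    let ψ : EuclideanSpace ℝ (Fin d) → ℤ × ℤ := fun x => (Z x i₁, Z x i₂)
    have hinj : Set.InjOn ψ (X.filter fun x => φ x = t) := by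
      intro x hx y hy hxy
      obtain ⟨hx, hx'⟩ := hmem x hx
      obtain ⟨hy, hy'⟩ := hmem y hy
      have hcoord : ∀ i, Z x i = Z y i → x i = y i := by
        intro i h
        have h' : (Z x i : ℝ) = Z y i := by rw [h]
        rw [hZ x hx, hZ y hy] at h'
        exact mul_right_cancel₀ hL0.ne' h'
      ext i
      by_cases h₁ : i = i₁
      · rw [h₁]; exact hcoord _ (congrArg Prod.fst hxy)
      by_cases h₂ : i = i₂
      · rw [h₂]; exact hcoord _ (congrArg Prod.snd hxy)
      · rw [hx' ⟨i, h₁, h₂⟩, hy' ⟨i, h₁, h₂⟩]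
    rw [← Finset.card_image_of_injOn hinj]
    set s : ℝ := t ⟨0, h01, h02⟩ / L with hs
    set r : ℝ := ∑ j : J, (t j / L : ℝ) ^ 2 with hr
    set r' : ℝ := ∑ j : J, (a j.1 - t j / L : ℝ) ^ 2 with hr'
    set m : ℝ := a 0 with hm
    have hmκ : κ / 2 ≤ |m| := ha
    have hm0 : m ≠ 0 := abs_pos.1 (lt_of_lt_of_le (by positivity) hmκ)
    -- Completing the square: the coefficients `s` and `m - s` of the two quadratic parts add up to
    -- `m`, and `(p, q)` is the resulting center.
    set p : ℝ := (m - s) * a i₁ / m with hp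
    set q : ℝ := (m - s) * a i₂ / m with hq
    set W : ℝ := s * r + (m - s) * (r' + a i₁ ^ 2 + a i₂ ^ 2) - m * (p ^ 2 + q ^ 2) - Lam a - σ
      with hW
    refine card_annulus_le _ N (p * L) (q * L) (-(W / m) * L ^ 2) R hR0.le ?_ ?_
    · intro y hy
      obtain ⟨x, hx, rfl⟩ := Finset.mem_image.1 hy
      exact ⟨hZN x (hmem x hx).1 _, hZN x (hmem x hx).1 _⟩
    · intro y hy
      obtain ⟨x, hx, rfl⟩ := Finset.mem_image.1 hy
      obtain ⟨hx, hx'⟩ := hmem x hx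
      have hen := (hX x hx).2.2
      have hx0 : x 0 = s := hx' ⟨0, h01, h02⟩
      have hrx : rest x = r := Finset.sum_congr rfl fun j _ => by rw [hx' j]
      have hrx' : rest (a - x) = r' :=
        Finset.sum_congr rfl fun j _ => by rw [PiLp.sub_apply, hx' j]
      have hpm : p * m = (m - s) * a i₁ := div_mul_cancel₀ _ hm0
      have hqm : q * m = (m - s) * a i₂ := div_mul_cancel₀ _ hm0
      have hE : Lam x + Lam (a - x) - Lam a - σ = m * ((x i₁ - p) ^ 2 + (x i₂ - q) ^ 2) + W := by
        have e₁ : Lam x = s * (x i₁ ^ 2 + x i₂ ^ 2 + r) := by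
          rw [Lam, xcoord, hsq, hrx, hx0]
        have e₂ : Lam (a - x) = (m - s) * ((a i₁ - x i₁) ^ 2 + (a i₂ - x i₂) ^ 2 + r') := by
          rw [Lam, xcoord, hsq, hrx', PiLp.sub_apply, PiLp.sub_apply, PiLp.sub_apply, hx0]
        rw [e₁, e₂, hW]
        linear_combination (2 * x i₁) * hpm + (2 * x i₂) * hqm
      rw [hE] at hen
      simp only [ψ, hZ x hx]
      have hfac : (x i₁ * L - p * L) ^ 2 + (x i₂ * L - q * L) ^ 2 - -(W / m) * L ^ 2 =
          (m * ((x i₁ - p) ^ 2 + (x i₂ - q) ^ 2) + W) / m * L ^ 2 := by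
        field_simp
        ring
      rw [hfac, abs_mul, abs_div, abs_of_pos (by positivity : 0 < L ^ 2), hR]
      have h₁ : |m * ((x i₁ - p) ^ 2 + (x i₂ - q) ^ 2) + W| / |m| ≤ τ / (κ / 2) :=
        div_le_div₀ hτ0.le hen (by positivity) hmκ
      calc _ ≤ τ / (κ / 2) * L ^ 2 := mul_le_mul_of_nonneg_right h₁ (by positivity)
        _ = _ := by field_simp
  have hmaps : ∀ x ∈ X, φ x ∈ T := fun x hx =>
    Fintype.mem_piFinset.2 fun j => Finset.mem_Icc.2 (abs_le.1 (hZN x hx j.1))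
  have hsum : (X.card : ℝ) = ∑ t ∈ T, ((X.filter fun x => φ x = t).card : ℝ) := by
    exact_mod_cast Finset.card_eq_sum_card_fiberwise hmaps
  have hNpos : (0 : ℝ) < 2 * N + 1 := by positivity
  have hlogN : 1 + Real.log (2 * N + 1) ≤ (1 + Real.log b) * (1 + Real.log L) := by
    have h := Real.log_le_log hNpos hNb
    rw [Real.log_mul (by linarith) hL0.ne'] at h
    nlinarith [mul_nonneg hlogb hlogL]
  -- The lower bound on `τ` and `κ ≤ 1` make the annulus thick enough to absorb the term linear in
  -- `N`.
  have hbR : b * L ≤ b / (2 * c₁) * R := by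
    have h₁ : c₁ ≤ τ * L := (div_le_iff₀ hL0).1 hτ
    have h₂ : 2 * c₁ * L ≤ R := by
      rw [hR, le_div_iff₀ hκ]
      calc 2 * c₁ * L * κ ≤ 2 * c₁ * L * 1 := by gcongr
        _ = 2 * c₁ * L := mul_one _
        _ ≤ 2 * (τ * L) * L := by gcongr
        _ = _ := by ring
    calc b * L = b / (2 * c₁) * (2 * c₁ * L) := by field_simp
      _ ≤ _ := by gcongr
  have hMle : M ≤ R * (1 + Real.log L) * (2 * b / c₁ + 48 * (1 + Real.log b)) := by
    have h₁ : 4 * (2 * N + 1 : ℝ) ≤ 2 * b / c₁ * R := by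
      calc 4 * (2 * N + 1 : ℝ) ≤ 4 * (b / (2 * c₁) * R) := by linarith
        _ = _ := by field_simp; ring
    have h₂ : 48 * R * (1 + Real.log (2 * N + 1)) ≤
        48 * R * ((1 + Real.log b) * (1 + Real.log L)) := by gcongr
    have h₃ : 0 ≤ 2 * b / c₁ * R * Real.log L := by positivity
    rw [hM]
    linarith
  have hM0 : 0 ≤ M := by
    have : 0 ≤ Real.log (2 * N + 1) := Real.log_nonneg (by linarith [(N.cast_nonneg : (0:ℝ) ≤ N)])
    positivity
  calc (X.card : ℝ) ≤ T.card * M := by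
        rw [hsum, ← nsmul_eq_mul]
        exact Finset.sum_le_card_nsmul _ _ _ hfib
    _ = (2 * N + 1) ^ (d - 2) * M := by rw [hT]
    _ ≤ (b * L) ^ (d - 2) * (R * (1 + Real.log L) * (2 * b / c₁ + 48 * (1 + Real.log b))) := by
        gcongr
    _ = _ := by
        rw [hR, mul_pow, ← Nat.sub_add_cancel (show 2 ≤ d by omega), pow_add L,
          Nat.add_sub_cancel]
        ring

end ZK

/-! ### Assembling the bound -/

/-- An infinite set would contain `⌊b⌋₊ + 1` points, so no separate finiteness proof is needed. -/
theorem Set.encard_le_ofReal_of_forall_finset {β : Type*} (s : Set β) (b : ℝ)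
    (h : ∀ F : Finset β, (F : Set β) ⊆ s → (F.card : ℝ) ≤ b) :
    (s.encard : ℝ≥0∞) ≤ ENNReal.ofReal b := by
  rcases s.finite_or_infinite with hs | hs
  · have h' := h hs.toFinset (by simp)
    rw [hs.encard_eq_coe_toFinset_card, ENat.toENNReal_coe, ← ENNReal.ofReal_natCast]
    exact ENNReal.ofReal_le_ofReal h'
  · obtain ⟨F, hF, hcard⟩ := hs.exists_subset_card_eq (⌊b⌋₊ + 1)
    have h' := h F hF
    rw [hcard] at h'
    push_cast at h'
    exact absurd h' (not_le.2 (Nat.lt_floor_add_one b))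

namespace ZK

variable {d : ℕ} [NeZero d]

theorem isFlow_of_mem_system {c₀ c₁ c₂ ε L α : ℝ} {C : Couple} {κ : C.NormalEdge → ℝ}
    {σ : C.Node → ℝ} {k : C.TreeEdge → EuclideanSpace ℝ (Fin d)}
    (hk : k ∈ system c₀ c₁ c₂ ε L α C κ σ) : C.IsFlow k :=
  ⟨hk.2.1, hk.2.2.2.1⟩

theorem sub_mem_flows {c₀ c₁ c₂ ε L α : ℝ} {C : Couple} {κ : C.NormalEdge → ℝ}
    {σ : C.Node → ℝ} {c : EuclideanSpace ℝ (Fin d)}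
    {k k' : C.TreeEdge → EuclideanSpace ℝ (Fin d)}
    (hk : k ∈ oneFixed c₀ c₁ c₂ ε L α C κ σ 0 c) (hk' : k' ∈ oneFixed c₀ c₁ c₂ ε L α C κ σ 0 c)
    (i : Fin d) : (fun e => k e i - k' e i) ∈ C.flows ∅ := by
  have hf := isFlow_of_mem_system hk.1
  have hf' := isFlow_of_mem_system hk'.1
  have h0 : k (C.leg 0) = k' (C.leg 0) := hk.2.trans hk'.2.symm
  have h1 : k (C.leg 1) = k' (C.leg 1) := by
    rw [hf.leg_zero_eq_neg, hf'.leg_zero_eq_neg] at h0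
    exact neg_injective h0
  refine ⟨⟨fun ℓ => ?_, fun v => ?_⟩, fun j => ?_, fun v hv => hv.elim⟩
  · simp only [hf.pair ℓ, hf'.pair ℓ, PiLp.neg_apply]
    ring
  · have e := congrArg (fun x : EuclideanSpace ℝ (Fin d) => x i) (hf.node v)
    have e' := congrArg (fun x : EuclideanSpace ℝ (Fin d) => x i) (hf'.node v)
    simp only [PiLp.sub_apply, PiLp.add_apply, PiLp.zero_apply] at e e'
    linarith
  · fin_cases j
    · exact sub_eq_zero.2 (congrArg (fun x : EuclideanSpace ℝ (Fin d) => x i) h0)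
    · exact sub_eq_zero.2 (congrArg (fun x : EuclideanSpace ℝ (Fin d) => x i) h1)

theorem oneFixed_one_subset (c₀ c₁ c₂ ε L α : ℝ) (C : Couple) (κ : C.NormalEdge → ℝ)
    (σ : C.Node → ℝ) (c : EuclideanSpace ℝ (Fin d)) :
    oneFixed c₀ c₁ c₂ ε L α C κ σ 1 c ⊆ oneFixed c₀ c₁ c₂ ε L α C κ σ 0 (-c) := fun k hk =>
  ⟨hk.1, by rw [(isFlow_of_mem_system hk.1).leg_zero_eq_neg, hk.2]⟩

theorem bound_eq_top {d : ℕ} {A θ ε L α : ℝ} (hL : 0 < L) (hα : 0 < α) {C : Couple}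
    {κ : C.NormalEdge → ℝ} {e : C.NormalEdge} (he : κ e = 0) : bound d A θ ε L α C κ = ⊤ := by
  have hQ : 0 < Q d ε L α := by unfold Q Tmax; positivity
  refine ENNReal.mul_eq_top.2 (.inl ⟨?_, ?_⟩)
  · exact (ENNReal.ofReal_pos.2 (by positivity)).ne'
  · classical
    rw [← Finset.mul_prod_erase _ _ (Finset.mem_univ e), he, ENNReal.ofReal_zero, ENNReal.inv_zero]
    exact ENNReal.top_mul (Finset.prod_ne_zero_iff.2 fun _ _ =>
      ENNReal.inv_ne_zero.2 ENNReal.ofReal_ne_top)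

theorem dyadic_pos {α x : ℝ} (hx : x ∈ dyadic α) : 0 < x := by
  obtain ⟨K, -, -, rfl⟩ := hx
  positivity

theorem dyadic_le_one {α x : ℝ} (hx : x ∈ dyadic α) : x ≤ 1 := by
  obtain ⟨K, hK, -, rfl⟩ := hx
  exact zpow_le_one_of_nonpos₀ one_le_two (by omega)

theorem Tmax_pos {ε L α : ℝ} (hL : 0 < L) (hα : 0 < α) : 0 < Tmax ε L α := by
  unfold Tmax; positivity

/-- This is where `α⁻¹ ≤ L ^ (1 / 2)` is spent: the energy window `c₁ / Tmax` is then at least `c₁ /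
L`, as `card_node_le` requires. -/
theorem Tmax_le {ε L α : ℝ} (hε : 0 < ε) (hL : 1 ≤ L) (hα : 0 < α)
    (hαL : α⁻¹ ≤ L ^ (1 / 2 : ℝ)) : Tmax ε L α ≤ L := by
  have hL0 : 0 < L := by linarith
  have h₁ : L ^ (-ε) ≤ 1 := Real.rpow_le_one_of_one_le_of_nonpos hL (by linarith)
  have h₂ : (α ^ 2)⁻¹ ≤ L := by
    rw [← inv_pow]
    calc α⁻¹ ^ 2 ≤ (L ^ (1 / 2 : ℝ)) ^ 2 := by gcongr
      _ = L := by rw [← Real.sqrt_eq_rpow, Real.sq_sqrt hL0.le]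
  calc Tmax ε L α ≤ 1 * (α ^ 2)⁻¹ := mul_le_mul_of_nonneg_right h₁ (by positivity)
    _ ≤ L := by rwa [one_mul]

theorem one_le_Q {d : ℕ} (hd : 3 ≤ d) {ε L α : ℝ} (hε : 0 < ε) (hL : 1 ≤ L) (hα : 0 < α)
    (hαL : α⁻¹ ≤ L ^ (1 / 2 : ℝ)) : 1 ≤ Q d ε L α := by
  rw [Q, ← div_eq_mul_inv, one_le_div (Tmax_pos (by linarith) hα)]
  exact (Tmax_le hε hL hα hαL).trans (le_self_pow₀ hL (by omega))

theorem eventually_log_le (K θ : ℝ) (hθ : 0 < θ) :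
    ∃ L₀ : ℝ, 1 ≤ L₀ ∧ ∀ L, L₀ ≤ L → K * (1 + Real.log L) ≤ L ^ θ := by
  have h₁ : (fun L : ℝ => K * (1 + Real.log L)) =o[Filter.atTop] fun L : ℝ => L ^ θ := by
    refine Asymptotics.IsLittleO.const_mul_left (Asymptotics.IsLittleO.add ?_
      (isLittleO_log_rpow_atTop hθ)) K
    refine (Asymptotics.isLittleO_const_left).2 (.inr ?_)
    exact Filter.tendsto_abs_atTop_atTop.comp (tendsto_rpow_atTop hθ)
  obtain ⟨L₀, hL₀⟩ := Filter.eventually_atTop.1 (h₁.bound one_pos)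
  refine ⟨max 1 L₀, le_max_left _ _, fun L hL => ?_⟩
  have h := hL₀ L ((le_max_right _ _).trans hL)
  have hL1 : 0 ≤ L := zero_le_one.trans ((le_max_left _ _).trans hL)
  rw [one_mul, Real.norm_of_nonneg (Real.rpow_nonneg hL1 θ)] at h
  exact (le_abs_self _).trans h

theorem encard_oneFixed_zero_le (hd : 3 ≤ d) {c₀ c₁ c₂ K θ ε L α : ℝ}
    (hθ : 0 < θ) (hε : 0 < ε) (hL : 1 ≤ L) (hα : 0 < α) (hαL : α⁻¹ ≤ L ^ (1 / 2 : ℝ))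
    (hc₁ : 0 < c₁)
    (hK : ∀ L : ℝ, 1 ≤ L → ∀ τ : ℝ, c₁ / L ≤ τ → ∀ κ : ℝ, 0 < κ → κ ≤ 1 →
      ∀ a : EuclideanSpace ℝ (Fin d), κ / 2 ≤ |xcoord a| → ∀ σ : ℝ,
      ∀ X : Finset (EuclideanSpace ℝ (Fin d)),
        (∀ x ∈ X, x ∈ lattice d L ∧ ‖x‖ ≤ c₀ ∧ |Lam x + Lam (a - x) - Lam a - σ| ≤ τ) →
        (X.card : ℝ) ≤ K * (1 + Real.log L) * (L ^ d * τ / κ))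
    (hLK : K * c₁ * (1 + Real.log L) ≤ L ^ θ)
    {C : Couple} (hC : C.IsConnected) {κ : C.NormalEdge → ℝ} (hκ : ∀ e, κ e ∈ dyadic α)
    (σ : C.Node → ℝ) (c : EuclideanSpace ℝ (Fin d)) :
    ((oneFixed c₀ c₁ c₂ ε L α C κ σ 0 c).encard : ℝ≥0∞) ≤ bound d 1 θ ε L α C κ := by
  have hL0 : 0 < L := by linarith
  have hT := Tmax_pos (ε := ε) hL0 hα
  have hQ := one_le_Q hd hε hL hα hαL
  have hQ0 : 0 ≤ Q d ε L α := zero_le_one.trans hQ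
  have hLθ : 1 ≤ L ^ θ := Real.one_le_rpow hL hθ.le
  have hLθ0 : 0 ≤ L ^ θ := zero_le_one.trans hLθ
  have hB : 1 ≤ L ^ θ * Q d ε L α := one_le_mul_of_one_le_of_one_le hLθ hQ
  have hw : ∀ v, 1 ≤ (κ v)⁻¹ := fun v => (one_le_inv₀ (dyadic_pos (hκ v))).2 (dyadic_le_one (hκ v))
  have hmain : ((oneFixed c₀ c₁ c₂ ε L α C κ σ 0 c).encard : ℝ≥0∞) ≤ ENNReal.ofReal
      ((L ^ θ * Q d ε L α) ^ Module.finrank ℝ (C.flows ∅) * ∏ v, (κ v)⁻¹) := by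
    refine Set.encard_le_ofReal_of_forall_finset _ _ fun F hF => ?_
    refine C.card_le_pow_finrank_flows (fun v => (κ v)⁻¹) _ hB hw
      (oneFixed c₀ c₁ c₂ ε L α C κ σ 0 c) (fun k hk k' hk' i => sub_mem_flows hk hk' i) ?_ F hF
    intro v a X hX
    rcases X.eq_empty_or_nonempty with rfl | ⟨x₀, hx₀⟩
    · have := zero_le_one.trans (hw v)
      simp only [Finset.card_empty, Nat.cast_zero]
      positivity
    have ha : κ v / 2 ≤ |xcoord a| := by
      obtain ⟨k, hk, rfl, -⟩ := hX x₀ hx₀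
      exact ((hk.1.2.2.1 v).1 (dyadic_pos (hκ v)).ne').1
    have h := hK L hL (c₁ * (Tmax ε L α)⁻¹) (by
        rw [div_eq_mul_inv]
        exact mul_le_mul_of_nonneg_left (inv_anti₀ hT (Tmax_le hε hL hα hαL)) hc₁.le)
      (κ v) (dyadic_pos (hκ v)) (dyadic_le_one (hκ v)) a ha (σ v) X (by
        intro x hx
        obtain ⟨k, hk, rfl, rfl⟩ := hX x hx
        obtain ⟨⟨h₁, -, -, h₄, h₅⟩, -⟩ := hk
        refine ⟨(h₁ _).1, (h₁ _).2, ?_⟩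
        have e : k (C.parent v) - k (C.child₁ v) = k (C.child₂ v) := by
          rw [← sub_eq_zero.1 (h₄ v), add_sub_cancel_left]
        rw [e]
        exact h₅ v)
    refine h.trans ?_
    calc K * (1 + Real.log L) * (L ^ d * (c₁ * (Tmax ε L α)⁻¹) / κ v)
        = K * c₁ * (1 + Real.log L) * (Q d ε L α * (κ v)⁻¹) := by rw [Q]; ring
      _ ≤ L ^ θ * (Q d ε L α * (κ v)⁻¹) := by
          have := zero_le_one.trans (hw v)
          exact mul_le_mul_of_nonneg_right hLK (by positivity)
      _ = _ := by ring
  refine hmain.trans ?_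
  have hprod : 0 ≤ ∏ v, (κ v)⁻¹ := Finset.prod_nonneg fun v _ => zero_le_one.trans (hw v)
  rw [ENNReal.ofReal_mul' hprod, ENNReal.ofReal_prod_of_nonneg fun v _ => zero_le_one.trans (hw v),
    bound]
  simp only [ENNReal.ofReal_inv_of_pos (dyadic_pos (hκ _))]
  refine mul_le_mul_left (ENNReal.ofReal_le_ofReal ?_) _
  -- The base `L ^ θ * Q` is at least `1`, so the rank may be replaced by `n / 2`. The loss `L ^ (θ
  -- * n / 2)` fits into `A = 1`.
  have hrank : (Module.finrank ℝ (C.flows ∅) : ℝ) ≤ C.numNodes / 2 := by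
    have h : (2 * Module.finrank ℝ (C.flows ∅) : ℝ) ≤ C.numNodes := by
      exact_mod_cast hC.two_mul_finrank_flows_le
    linarith
  have hn : (0 : ℝ) ≤ C.numNodes := Nat.cast_nonneg _
  calc (L ^ θ * Q d ε L α) ^ Module.finrank ℝ (C.flows ∅)
      = (L ^ θ * Q d ε L α) ^ (Module.finrank ℝ (C.flows ∅) : ℝ) := (Real.rpow_natCast _ _).symm
    _ ≤ (L ^ θ * Q d ε L α) ^ ((C.numNodes : ℝ) / 2) := Real.rpow_le_rpow_of_exponent_le hB hrank
    _ = L ^ (θ * (C.numNodes / 2)) * Q d ε L α ^ ((C.numNodes : ℝ) / 2) := by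
        rw [Real.mul_rpow hLθ0 hQ0, ← Real.rpow_mul hL0.le]
    _ ≤ _ := by
        refine mul_le_mul_of_nonneg_right (Real.rpow_le_rpow_of_exponent_le hL ?_)
          (Real.rpow_nonneg hQ0 _)
        nlinarith [mul_nonneg hn hθ.le]

end ZK

theorem proposition3 (d : ℕ) [NeZero d] (hd : 3 ≤ d) (c₀ c₁ c₂ : ℝ)
    (hc₀ : 0 < c₀) (hc₁ : 0 < c₁) (hc₂ : 0 < c₂) :
    ∃ A : ℝ, 0 < A ∧ ∀ θ : ℝ, 0 < θ → ∀ ε : ℝ, 0 < ε → ∃ L₀ : ℝ, 1 ≤ L₀ ∧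
      ∀ L : ℝ, L₀ ≤ L → ∀ α : ℝ, 0 < α → α⁻¹ ≤ L ^ (1 / 2 : ℝ) →
      ∀ C : Couple, C.IsConnected →
      ∀ κ : C.NormalEdge → ℝ, (∀ e, κ e ∈ {0} ∪ ZK.dyadic α) →
      ∀ (σ : C.Node → ℝ) (c : EuclideanSpace ℝ (Fin d)),
        (∀ i : Fin 2, ((ZK.oneFixed c₀ c₁ c₂ ε L α C κ σ i c).encard : ENNReal) ≤
          ZK.bound d A θ ε L α C κ) ∧
        ((ZK.bothFixed c₀ c₁ c₂ ε L α C κ σ c).encard : ENNReal) ≤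
          ZK.bound d A θ ε L α C κ := by
  obtain ⟨K, hK0, hK⟩ := ZK.card_node_le hd hc₀ hc₁
  refine ⟨1, one_pos, fun θ hθ ε hε => ?_⟩
  obtain ⟨L₀, hL₀, hlog⟩ := ZK.eventually_log_le (K * c₁) θ hθ
  refine ⟨L₀, hL₀, fun L hL α hα hαL C hC κ hκ σ c => ?_⟩
  have hL1 : 1 ≤ L := hL₀.trans hL
  -- A single vanishing `κ` makes the right-hand side infinite, so all `κ` may be taken dyadic.
  by_cases h0 : ∃ e, κ e = 0
  · obtain ⟨e, he⟩ := h0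
    simp only [ZK.bound_eq_top (by linarith : 0 < L) hα he, le_top, implies_true, and_self]
  · have hκ' : ∀ e, κ e ∈ ZK.dyadic α := fun e =>
      (hκ e).resolve_left fun h => h0 ⟨e, h⟩
    have hzero := ZK.encard_oneFixed_zero_le (c₂ := c₂) hd hθ hε hL1 hα hαL hc₁ hK (hlog L hL) hC
      hκ' σ
    have hmono : ∀ {s t : Set (C.TreeEdge → EuclideanSpace ℝ (Fin d))}, s ⊆ t →
        (s.encard : ENNReal) ≤ t.encard := fun h =>
      ENat.toENNReal_le.2 (Set.encard_le_encard h)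
    refine ⟨fun i => ?_, ?_⟩
    swap
    · have hsub : ZK.bothFixed c₀ c₁ c₂ ε L α C κ σ c ⊆ ZK.oneFixed c₀ c₁ c₂ ε L α C κ σ 0 c :=
        fun k hk => ⟨hk.1, hk.2.1⟩
      exact (hmono hsub).trans (hzero c)
    fin_cases i
    · exact hzero c
    · exact (hmono (ZK.oneFixed_one_subset c₀ c₁ c₂ ε L α C κ σ c)).trans (hzero (-c))
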